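/- Setting. Let $n, f$ be integers with $2f < n$. A committee of $n$ members, of which a set $C$ with $|C|\le f$ is corrupted, runs the following protocol for one time window. All algorithms depend on a security parameter $\lambda$; a function is negligible if it decreases faster than every inverse polynomial in $\lambda$; adversaries are probabilistic (non-uniform) Boolean circuit families of polynomial size. The primitives are a keyed hash function $H$ on bit strings of arbitrary length, a threshold encryption scheme (key generation giving a public key and one secret key per member, encryption, computation of decryption shares, combination of shares) whose algorithms have polynomial size, and a symmetric encryption scheme with correct decryption. Submission. Encrypted transactions $1,\dots,m$ (with $m = m(\lambda)$) are received. For an honest submission $k$ with payload $x_k$, the user samples a uniform symmetric key, encrypts $x_k$ under it and the key under the committee's public key, and attaches metadata and a signature. The submissions of malicious users are arbitrary strings chosen by the adversary. Submission $k$ has true arrival time $\mathrm{arrival}(tx_k)\in\mathbb R$; each honest committee member records a timestamp for it, and the deviations of the honest members' timestamps from the true arrival times (over all honest members and all submissions) differ from each other by at most $\alpha$ (bounded clock skew). The corrupted members' timestamps are chosen by the adversary. The recorded arrival time of a submission is the median of the $n$ timestamps. (Timestamps and votes are authentic. Payloads, arrival times and honest timestamps are arbitrary but fixed before the keys are generated.)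 Commitment. The sequencer, controlled by the adversary like the corrupted members and the malicious users, knows the hash key, the public key, the secret keys of the corrupted members and all encrypted transactions of honest users. It publishes a digest $\mathsf{comm}$ and shows each member a list of the $m$ encrypted transactions with their receipt numbers. An honest member approves if the list hashes to $\mathsf{comm}$ and consists of all received submissions, sorted by recorded arrival time; corrupted members vote as they like. Decryption. If more than $n/2$ members approve, the honest members release their decryption shares for all received submissions. Having seen these shares, the adversary chooses the shares of the corrupted members and opens the commitment with a list of $m$ entries, the final order. The batch is accepted and executed in this order if the list hashes to $\mathsf{comm}$; otherwise nothing is executed. Let $\pi(tx_k)$ be the first position of the executed batch that holds the entry of submission $k$ and, if the submission is honest, for which the committee's decryption of this submission is $x_k$; $\pi(tx_k)=\infty$ if there is none. Theorem ($(\alpha,\beta)$-Fairness of Ordering Service). Assume that $H$ is collision resistant (every polynomial-size adversary finds a collision with negligible probability only) and that threshold decryption is correct in the presence of at most $f$ Byzantine members (for every set of at most $f$ Byzantine members and every symmetric key, up to a negligible probability over key generation and encryption, the encrypted key is recovered from every vector of shares in which the honest members' shares are computed as prescribed). Then for every choice of arrival times, payloads and timestamps as above and every polynomial-size adversary there is a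 negligible function $\beta$ such that, for every $\lambda$ and all submissions $tx_i, tx_j$, $$\mathrm{arrival}(tx_i) < \mathrm{arrival}(tx_j)-\alpha \quad\Longrightarrow\quad \Pr[\pi(tx_j)<\pi(tx_i)]\le\beta(\lambda).$$ That is, the ordering protocol is $(\alpha,\mathrm{negl}(\lambda))$-fair. -/

import Mathlib

namespace FairOrdering

/-! ### Probability, negligible functions, Boolean circuits -/

/-- Bit strings of length `k`. -/
abbrev Bits (k : ℕ) : Type := Fin k → Bool

open Classical in
/-- Probability of the event `E` under the uniform distribution on the finite type `Ω`. -/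
noncomputable def prob {Ω : Type} [Fintype Ω] (E : Ω → Prop) : ℝ :=
  ((Finset.univ.filter E).card : ℝ) / (Fintype.card Ω : ℝ)

/-- `μ` is negligible in the security parameter: `κ ^ c * μ κ → 0` for every `c`. -/
def Negligible (μ : ℕ → ℝ) : Prop :=
  Asymptotics.SuperpolynomialDecay Filter.atTop (fun κ : ℕ => (κ : ℝ)) μ

/-- Boolean circuits (straight-line programs) with input wires `ι` and `g` gates. Each new gate is
a constant or the NAND of two wires, a wire being an input or the output of an earlier gate. -/
inductive Circuit (ι : Type) : ℕ → Type
  | nil : Circuit ι 0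
  | const {g : ℕ} (c : Circuit ι g) (b : Bool) : Circuit ι (g + 1)
  | nand {g : ℕ} (c : Circuit ι g) (u v : ι ⊕ Fin g) : Circuit ι (g + 1)

/-- The values of all wires of a circuit on the input `x`. -/
def Circuit.eval {ι : Type} : {g : ℕ} → Circuit ι g → (ι → Bool) → ι ⊕ Fin g → Bool
  | _, .nil, x => Sum.elim x Fin.elim0
  | _, .const c b, x => Sum.elim x (Fin.snoc (fun i => c.eval x (Sum.inr i)) b)
  | _, .nand c u v, x =>
      Sum.elim x (Fin.snoc (fun i => c.eval x (Sum.inr i)) (!(c.eval x u && c.eval x v)))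

/-- `f` is computed by a circuit whose number of gates plus number of outputs is at most `s`. -/
def HasCircuit {ι o : Type} [Fintype o] (f : (ι → Bool) → (o → Bool)) (s : ℕ) : Prop :=
  ∃ (g : ℕ) (c : Circuit ι g) (out : o → ι ⊕ Fin g),
    g + Fintype.card o ≤ s ∧ ∀ x j, f x j = c.eval x (out j)

/-- A family of functions, one for each security parameter, computed by circuits of polynomial
size. -/
def PolySize {ι o : ℕ → Type} [∀ κ, Fintype (o κ)]
    (f : ∀ κ, (ι κ → Bool) → (o κ → Bool)) : Prop :=
  ∃ P : Polynomial ℕ, ∀ κ, HasCircuit (f κ) (P.eval κ)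

/-! ### Collision-resistant hashing -/

/-- A keyed family of hash functions on bit strings of arbitrary length. -/
structure HashFamily where
  coinLen : ℕ → ℕ
  keyLen : ℕ → ℕ
  digestLen : ℕ → ℕ
  gen : ∀ κ, Bits (coinLen κ) → Bits (keyLen κ)
  hash : ∀ κ, Bits (keyLen κ) → List Bool → Bits (digestLen κ)

/-- A probabilistic polynomial-size collision finder: from the hash key and its own coins it
computes two messages. -/
structure CollisionFinder (H : HashFamily) where
  coinLen : ℕ → ℕ
  len₁ : ℕ → ℕ
  len₂ : ℕ → ℕ
  run : ∀ κ, (Fin (H.keyLen κ) ⊕ Fin (coinLen κ) → Bool) →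
    (Fin (len₁ κ) ⊕ Fin (len₂ κ) → Bool)
  polySize : PolySize run

/-- The collision finder outputs two different messages with the same digest. -/
def CollisionFinder.Succeeds {H : HashFamily} (A : CollisionFinder H) (κ : ℕ)
    (ω : Bits (H.coinLen κ) × Bits (A.coinLen κ)) : Prop :=
  let hk := H.gen κ ω.1
  let y := A.run κ (Sum.elim hk ω.2)
  let x₁ := List.ofFn fun i => y (Sum.inl i)
  let x₂ := List.ofFn fun i => y (Sum.inr i)
  x₁ ≠ x₂ ∧ H.hash κ hk x₁ = H.hash κ hk x₂

def HashFamily.CollisionResistant (H : HashFamily) : Prop :=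
  ∀ A : CollisionFinder H, Negligible fun κ => prob (A.Succeeds κ)

/-! ### Threshold encryption and symmetric encryption -/

/-- The algorithms of a threshold public-key encryption scheme for a committee of `n` members
(it encrypts symmetric keys of `keyLen` bits). `combine` gets one share from each member. -/
structure ThresholdScheme (n : ℕ) where
  dkgCoinLen : ℕ → ℕ
  encCoinLen : ℕ → ℕ
  pkLen : ℕ → ℕ
  skLen : ℕ → ℕ
  keyLen : ℕ → ℕ
  ctLen : ℕ → ℕ
  shareLen : ℕ → ℕ
  dkg : ∀ κ, Bits (dkgCoinLen κ) → Bits (pkLen κ) × (Fin n → Bits (skLen κ))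
  enc : ∀ κ, Bits (pkLen κ) → Bits (keyLen κ) → Bits (encCoinLen κ) → Bits (ctLen κ)
  shareDec : ∀ κ, Fin n → Bits (skLen κ) → Bits (ctLen κ) → Bits (shareLen κ)
  combine : ∀ κ, Bits (pkLen κ) → Bits (ctLen κ) → (Fin n → Bits (shareLen κ)) →
    Bits (keyLen κ)

/-- All four algorithms of the scheme are of polynomial size. -/
structure ThresholdScheme.IsEfficient {n : ℕ} (E : ThresholdScheme n) : Prop where
  dkg : PolySize (o := fun κ => Fin (E.pkLen κ) ⊕ (Fin n × Fin (E.skLen κ)))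
    fun κ (x : Fin (E.dkgCoinLen κ) → Bool) =>
      Sum.elim (E.dkg κ x).1 fun q => (E.dkg κ x).2 q.1 q.2
  enc : PolySize (o := fun κ => Fin (E.ctLen κ))
    fun κ (x : Fin (E.pkLen κ) ⊕ Fin (E.keyLen κ) ⊕ Fin (E.encCoinLen κ) → Bool) =>
      E.enc κ (fun b => x (.inl b)) (fun b => x (.inr (.inl b))) (fun b => x (.inr (.inr b)))
  shareDec : ∀ p : Fin n, PolySize (o := fun κ => Fin (E.shareLen κ))
    fun κ (x : Fin (E.skLen κ) ⊕ Fin (E.ctLen κ) → Bool) =>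
      E.shareDec κ p (fun b => x (.inl b)) (fun b => x (.inr b))
  combine : PolySize (o := fun κ => Fin (E.keyLen κ))
    fun κ (x : Fin (E.pkLen κ) ⊕ Fin (E.ctLen κ) ⊕ (Fin n × Fin (E.shareLen κ)) → Bool) =>
      E.combine κ (fun b => x (.inl b)) (fun b => x (.inr (.inl b)))
        (fun p b => x (.inr (.inr (p, b))))

/-- Correct threshold decryption in the presence of at most `f` Byzantine members: up to a
negligible probability over key generation and encryption, an honestly encrypted key is recovered
from any vector of shares in which the honest members' shares are computed as prescribed. -/
def ThresholdScheme.Correct {n : ℕ} (E : ThresholdScheme n) (f : ℕ) : Prop :=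
  ∀ C : Finset (Fin n), C.card ≤ f →
    ∃ ε : ℕ → ℝ, Negligible ε ∧ ∀ (κ : ℕ) (key : Bits (E.keyLen κ)),
      prob (fun ω : Bits (E.dkgCoinLen κ) × Bits (E.encCoinLen κ) =>
        let keys := E.dkg κ ω.1
        let ct := E.enc κ keys.1 key ω.2
        ∃ shares : Fin n → Bits (E.shareLen κ),
          (∀ p, p ∉ C → shares p = E.shareDec κ p (keys.2 p) ct) ∧
          E.combine κ keys.1 ct shares ≠ key) ≤ ε κ

/-- A symmetric encryption scheme with keys of `keyLen` bits. -/
structure SymScheme (keyLen : ℕ → ℕ) where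
  coinLen : ℕ → ℕ
  payloadLen : ℕ → ℕ
  ctLen : ℕ → ℕ
  enc : ∀ κ, Bits (keyLen κ) → Bits (payloadLen κ) → Bits (coinLen κ) → Bits (ctLen κ)
  dec : ∀ κ, Bits (keyLen κ) → Bits (ctLen κ) → Bits (payloadLen κ)
  dec_enc : ∀ κ key x r, dec κ key (enc κ key x r) = x

/-! ### The ordering protocol -/

/-- The primitives used by the ordering service of a committee of `n` members. `auxLen` is the
length of the field `(meta, σ)` of an encrypted transaction. -/
structure Primitives (n : ℕ) where
  hash : HashFamily
  thr : ThresholdScheme n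
  sym : SymScheme thr.keyLen
  auxLen : ℕ → ℕ

/-- Bit positions of an encrypted transaction `(ct_sym, ct_k, (meta, σ))`. -/
abbrev Primitives.TxWire {n : ℕ} (P : Primitives n) (κ : ℕ) : Type :=
  Fin (P.sym.ctLen κ) ⊕ Fin (P.thr.ctLen κ) ⊕ Fin (P.auxLen κ)

/-- Bit positions of an entry of the encrypted order, when `m` transactions were received: the
receipt number (one-hot) and the encrypted transaction. -/
abbrev Primitives.EntryWire {n : ℕ} (P : Primitives n) (m κ : ℕ) : Type :=
  Fin m ⊕ P.TxWire κ

/-- The entry for the encrypted transaction `tx` with receipt number `k`. -/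
def Primitives.entry {n : ℕ} (P : Primitives n) {m κ : ℕ} (k : Fin m)
    (tx : P.TxWire κ → Bool) : P.EntryWire m κ → Bool :=
  Sum.elim (fun b => decide (b = k)) tx

/-- The order of the bits of an entry in its serialization. -/
def Primitives.entryEquiv {n : ℕ} (P : Primitives n) (m κ : ℕ) :
    Fin (m + (P.sym.ctLen κ + (P.thr.ctLen κ + P.auxLen κ))) ≃ P.EntryWire m κ :=
  finSumFinEquiv.symm.trans <| Equiv.sumCongr (Equiv.refl _) <|
    finSumFinEquiv.symm.trans <| Equiv.sumCongr (Equiv.refl _) finSumFinEquiv.symm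

/-- Serialization of a list of `m` entries, entry after entry. -/
def Primitives.encode {n : ℕ} (P : Primitives n) {m κ : ℕ}
    (L : Fin m → P.EntryWire m κ → Bool) : List Bool :=
  List.ofFn fun t : Fin (m * (m + (P.sym.ctLen κ + (P.thr.ctLen κ + P.auxLen κ)))) =>
    L (finProdFinEquiv.symm t).1 (P.entryEquiv m κ (finProdFinEquiv.symm t).2)

/-- What happens in the time window, independently of the protocol: `m` submissions, their true
arrival times, which of them come from honest users, the plaintext transactions and the fields
`(meta, σ)` of the honest users, and the arrival times that the clocks of the committee members
record. (Only the values for honest users, respectively honest members, are used.) -/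
structure Workload {n : ℕ} (P : Primitives n) where
  m : ℕ → ℕ
  arrival : ∀ κ, Fin (m κ) → ℝ
  honest : ∀ κ, Finset (Fin (m κ))
  payload : ∀ κ, Fin (m κ) → Bits (P.sym.payloadLen κ)
  aux : ∀ κ, Fin (m κ) → Bits (P.sym.ctLen κ) → Bits (P.thr.ctLen κ) → Bits (P.auxLen κ)
  stamp : ∀ κ, Fin n → Fin (m κ) → ℕ

/-- Bounded clock skew: the deviations of the honest members' timestamps from the true arrival
times differ from each other by at most `α`. -/
def Workload.BoundedSkew {n : ℕ} {P : Primitives n} (W : Workload P) (C : Finset (Fin n))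
    (α : ℝ) : Prop :=
  ∀ κ, ∀ p ∉ C, ∀ q ∉ C, ∀ k l,
    ((W.stamp κ p k : ℝ) - W.arrival κ k) - ((W.stamp κ q l : ℝ) - W.arrival κ l) ≤ α

/-- The encrypted transaction submitted by the honest user of submission `k`. -/
def Workload.userTx {n : ℕ} {P : Primitives n} (W : Workload P) (κ : ℕ) (k : Fin (W.m κ))
    (pk : Bits (P.thr.pkLen κ)) (key : Bits (P.thr.keyLen κ)) (rSym : Bits (P.sym.coinLen κ))
    (rEnc : Bits (P.thr.encCoinLen κ)) : P.TxWire κ → Bool :=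
  let ctSym := P.sym.enc κ key (W.payload κ k) rSym
  let ctKey := P.thr.enc κ pk key rEnc
  Sum.elim ctSym (Sum.elim ctKey (W.aux κ k ctSym ctKey))

/-- Bit positions of the adversary's view before decryption: hash key, public key, secret keys of
the corrupted members, encrypted transactions of the honest users, and its own coins. -/
abbrev Workload.ViewWire {n : ℕ} {P : Primitives n} (W : Workload P) (coinLen : ℕ → ℕ)
    (κ : ℕ) : Type :=
  Fin (P.hash.keyLen κ) ⊕ Fin (P.thr.pkLen κ) ⊕ (Fin n × Fin (P.thr.skLen κ)) ⊕
    (Fin (W.m κ) × P.TxWire κ) ⊕ Fin (coinLen κ)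

/-- Bit positions of the adversary's view after decryption: in addition, the decryption shares of
the honest members for all received transactions. -/
abbrev Workload.LateViewWire {n : ℕ} {P : Primitives n} (W : Workload P) (coinLen : ℕ → ℕ)
    (κ : ℕ) : Type :=
  W.ViewWire coinLen κ ⊕ (Fin n × Fin (W.m κ) × Fin (P.thr.shareLen κ))

/-- A probabilistic polynomial-size adversary, which controls the sequencer, the corrupted committee
members and the malicious users. From its view before decryption it computes: the encrypted
transactions of malicious users, the timestamps (binary numbers) and approval votes of corrupted
members, the published commitment, and the encrypted order shown to each member. From its view after
decryption it computes the encrypted order with which it opens the commitment, and the decryption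
shares of corrupted members. -/
structure Adversary {n : ℕ} {P : Primitives n} (W : Workload P) where
  coinLen : ℕ → ℕ
  stampLen : ℕ → ℕ
  submit : ∀ κ, (W.ViewWire coinLen κ → Bool) → (Fin (W.m κ) × P.TxWire κ → Bool)
  stamp : ∀ κ, (W.ViewWire coinLen κ → Bool) → (Fin n × Fin (W.m κ) × Fin (stampLen κ) → Bool)
  vote : ∀ κ, (W.ViewWire coinLen κ → Bool) → (Fin n → Bool)
  comm : ∀ κ, (W.ViewWire coinLen κ → Bool) → (Fin (P.hash.digestLen κ) → Bool)
  proposal : ∀ κ, (W.ViewWire coinLen κ → Bool) →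
    (Fin n × Fin (W.m κ) × P.EntryWire (W.m κ) κ → Bool)
  opening : ∀ κ, (W.LateViewWire coinLen κ → Bool) →
    (Fin (W.m κ) × P.EntryWire (W.m κ) κ → Bool)
  share : ∀ κ, (W.LateViewWire coinLen κ → Bool) →
    (Fin n × Fin (W.m κ) × Fin (P.thr.shareLen κ) → Bool)
  submit_poly : PolySize submit
  stamp_poly : PolySize stamp
  vote_poly : PolySize vote
  comm_poly : PolySize comm
  proposal_poly : PolySize proposal
  opening_poly : PolySize opening
  share_poly : PolySize share

/-- The median of `n` timestamps: the least value that exceeds or equals more than half of them. -/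
noncomputable def medianStamp {n : ℕ} (R : Fin n → ℕ) : ℕ :=
  sInf {v | n < 2 * (Finset.univ.filter fun p => R p ≤ v).card}

namespace Adversary

variable {n : ℕ} {P : Primitives n} {W : Workload P}

/-- All coins of a run: for the hash key, for distributed key generation, the symmetric keys of the
users, their coins for symmetric and for threshold encryption, and the adversary's coins. -/
abbrev Coins (A : Adversary W) (κ : ℕ) : Type :=
  Bits (P.hash.coinLen κ) × Bits (P.thr.dkgCoinLen κ) × (Fin (W.m κ) → Bits (P.thr.keyLen κ)) ×
    (Fin (W.m κ) → Bits (P.sym.coinLen κ)) × (Fin (W.m κ) → Bits (P.thr.encCoinLen κ)) ×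
    Bits (A.coinLen κ)

def hashKey (A : Adversary W) (κ : ℕ) (ω : A.Coins κ) : Bits (P.hash.keyLen κ) :=
  P.hash.gen κ ω.1

def publicKey (A : Adversary W) (κ : ℕ) (ω : A.Coins κ) : Bits (P.thr.pkLen κ) :=
  (P.thr.dkg κ ω.2.1).1

def secretKey (A : Adversary W) (κ : ℕ) (ω : A.Coins κ) (p : Fin n) : Bits (P.thr.skLen κ) :=
  (P.thr.dkg κ ω.2.1).2 p

/-- The encrypted transaction that the honest user of submission `k` makes. -/
def userTx (A : Adversary W) (κ : ℕ) (ω : A.Coins κ) (k : Fin (W.m κ)) : P.TxWire κ → Bool :=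
  W.userTx κ k (A.publicKey κ ω) (ω.2.2.1 k) (ω.2.2.2.1 k) (ω.2.2.2.2.1 k)

/-- The adversary's view before decryption; what it does not see is blanked out. -/
def view (A : Adversary W) (C : Finset (Fin n)) (κ : ℕ) (ω : A.Coins κ) :
    W.ViewWire A.coinLen κ → Bool :=
  Sum.elim (A.hashKey κ ω) <| Sum.elim (A.publicKey κ ω) <|
    Sum.elim (fun q => if q.1 ∈ C then A.secretKey κ ω q.1 q.2 else false) <|
    Sum.elim (fun q => if q.1 ∈ W.honest κ then A.userTx κ ω q.1 q.2 else false)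
      ω.2.2.2.2.2

/-- The encrypted transaction received as submission `k`. -/
def txEnc (A : Adversary W) (C : Finset (Fin n)) (κ : ℕ) (ω : A.Coins κ) (k : Fin (W.m κ)) :
    P.TxWire κ → Bool :=
  if k ∈ W.honest κ then A.userTx κ ω k else fun b => A.submit κ (A.view C κ ω) (k, b)

def ctSym (A : Adversary W) (C : Finset (Fin n)) (κ : ℕ) (ω : A.Coins κ) (k : Fin (W.m κ)) :
    Bits (P.sym.ctLen κ) :=
  fun b => A.txEnc C κ ω k (.inl b)

def ctKey (A : Adversary W) (C : Finset (Fin n)) (κ : ℕ) (ω : A.Coins κ) (k : Fin (W.m κ)) :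
    Bits (P.thr.ctLen κ) :=
  fun b => A.txEnc C κ ω k (.inr (.inl b))

/-- The timestamp of submission `k` in the name of committee member `p`. -/
def memberStamp (A : Adversary W) (C : Finset (Fin n)) (κ : ℕ) (ω : A.Coins κ) (p : Fin n)
    (k : Fin (W.m κ)) : ℕ :=
  if p ∈ C then Nat.ofBits fun b => A.stamp κ (A.view C κ ω) (p, k, b) else W.stamp κ p k

/-- The arrival time recorded by the committee for submission `k`. -/
noncomputable def recorded (A : Adversary W) (C : Finset (Fin n)) (κ : ℕ) (ω : A.Coins κ)
    (k : Fin (W.m κ)) : ℕ :=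
  medianStamp fun p => A.memberStamp C κ ω p k

/-- The list `L` consists of all received encrypted transactions, sorted by recorded arrival
time (ties in any order). -/
def IsArrivalOrder (A : Adversary W) (C : Finset (Fin n)) (κ : ℕ) (ω : A.Coins κ)
    (L : Fin (W.m κ) → P.EntryWire (W.m κ) κ → Bool) : Prop :=
  ∃ τ : Equiv.Perm (Fin (W.m κ)), Monotone (fun a => A.recorded C κ ω (τ a)) ∧
    ∀ a, L a = P.entry (τ a) (A.txEnc C κ ω (τ a))

/-- The digest of the list `L` is the published commitment. -/
def Opens (A : Adversary W) (C : Finset (Fin n)) (κ : ℕ) (ω : A.Coins κ)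
    (L : Fin (W.m κ) → P.EntryWire (W.m κ) κ → Bool) : Prop :=
  P.hash.hash κ (A.hashKey κ ω) (P.encode L) = A.comm κ (A.view C κ ω)

/-- Member `p` approves the commitment. An honest member does so if the list that it was shown
opens the commitment and is sorted by recorded arrival time. -/
def Approves (A : Adversary W) (C : Finset (Fin n)) (κ : ℕ) (ω : A.Coins κ) (p : Fin n) : Prop :=
  (p ∈ C ∧ A.vote κ (A.view C κ ω) p = true) ∨
  (p ∉ C ∧ A.Opens C κ ω (fun a b => A.proposal κ (A.view C κ ω) (p, a, b)) ∧
    A.IsArrivalOrder C κ ω (fun a b => A.proposal κ (A.view C κ ω) (p, a, b)))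

open Classical in
/-- A majority of the committee approves the commitment. Decryption starts only then. -/
def Committed (A : Adversary W) (C : Finset (Fin n)) (κ : ℕ) (ω : A.Coins κ) : Prop :=
  n < 2 * (Finset.univ.filter fun p => A.Approves C κ ω p).card

/-- The adversary's view after decryption. (It is used only in runs in which decryption
takes place.) -/
def lateView (A : Adversary W) (C : Finset (Fin n)) (κ : ℕ) (ω : A.Coins κ) :
    W.LateViewWire A.coinLen κ → Bool :=
  Sum.elim (A.view C κ ω) fun q =>
    if q.1 ∈ C then false
    else P.thr.shareDec κ q.1 (A.secretKey κ ω q.1) (A.ctKey C κ ω q.2.1) q.2.2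

/-- The encrypted order with which the sequencer finally opens the commitment; the batch is
executed in this order. -/
def finalOrder (A : Adversary W) (C : Finset (Fin n)) (κ : ℕ) (ω : A.Coins κ) :
    Fin (W.m κ) → P.EntryWire (W.m κ) κ → Bool :=
  fun a b => A.opening κ (A.lateView C κ ω) (a, b)

/-- The decryption share of member `p` for submission `k`. -/
def memberShare (A : Adversary W) (C : Finset (Fin n)) (κ : ℕ) (ω : A.Coins κ)
    (k : Fin (W.m κ)) (p : Fin n) : Bits (P.thr.shareLen κ) :=
  if p ∈ C then fun b => A.share κ (A.lateView C κ ω) (p, k, b)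
  else P.thr.shareDec κ p (A.secretKey κ ω p) (A.ctKey C κ ω k)

/-- The plaintext that the committee decrypts for submission `k`. -/
def plaintext (A : Adversary W) (C : Finset (Fin n)) (κ : ℕ) (ω : A.Coins κ)
    (k : Fin (W.m κ)) : Bits (P.sym.payloadLen κ) :=
  P.sym.dec κ
    (P.thr.combine κ (A.publicKey κ ω) (A.ctKey C κ ω k) (A.memberShare C κ ω k))
    (A.ctSym C κ ω k)

/-- The batch passes verification and is forwarded to execution. -/
def Accepted (A : Adversary W) (C : Finset (Fin n)) (κ : ℕ) (ω : A.Coins κ) : Prop :=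
  A.Committed C κ ω ∧ A.Opens C κ ω (A.finalOrder C κ ω)

/-- Slot `a` of the executed batch executes transaction `k`: the entry in this slot is the one of
submission `k` and, if its user is honest, what is decrypted is the user's transaction. -/
def Executes (A : Adversary W) (C : Finset (Fin n)) (κ : ℕ) (ω : A.Coins κ)
    (a k : Fin (W.m κ)) : Prop :=
  A.Accepted C κ ω ∧ A.finalOrder C κ ω a = P.entry k (A.txEnc C κ ω k) ∧
    (k ∈ W.honest κ → A.plaintext C κ ω k = W.payload κ k)

/-- The position of transaction `k` in the executed batch, `⊤` if it is not executed. -/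
noncomputable def position (A : Adversary W) (C : Finset (Fin n)) (κ : ℕ) (ω : A.Coins κ)
    (k : Fin (W.m κ)) : ℕ∞ :=
  ⨅ (a : Fin (W.m κ)) (_ : A.Executes C κ ω a k), ((a : ℕ) : ℕ∞)

end Adversary

/-- `(α, β)`-fairness of a randomized ordering policy `pos` (with coins in `Ω`) for transactions
with the given arrival times. -/
def IsFair {Ω : Type} [Fintype Ω] {m : ℕ} (arrival : Fin m → ℝ) (pos : Ω → Fin m → ℕ∞)
    (α β : ℝ) : Prop :=
  ∀ i j, arrival i < arrival j - α → prob (fun ω => pos ω j < pos ω i) ≤ β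

end FairOrdering

open FairOrdering

/-! The argument is a case distinction valid in every run, followed by a union bound. Since `2 *
C.card < n`, the median of the timestamps of a submission is trapped between honest ones. Bounded
skew puts every honest timestamp of `i` below every honest timestamp of `j`, so the recorded times
of `i` and `j` are strictly ordered whatever the corrupted members report (`recorded_lt_recorded`).

If `j` is executed before `i`, the batch was accepted, so a majority approved, and this majority
contains an honest member. That member saw a sorted list opening the commitment. Either the final
order is a different opening, or it is this sorted list; in the latter case the slot of `i` precedes
that of `j`, and only a wrong decryption of an honest `i` can keep it from counting
(`misordering_cases`).

Wrong decryption is negligible by correctness of the threshold scheme (`prob_plaintext_ne_le`). Two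
openings serialize to a hash collision (`exists_negligible_equivocates`): a non-uniform reduction
hard-wires the best values of all coins other than those of the hash key. It then knows every secret
key, so it can simulate the honest shares and run the adversary to its opening. The circuit calculus
below bounds the size of this reduction. -/

namespace FairOrdering

/-! ### Composition of circuits -/

lemma Circuit.eval_inl {ι : Type} {g : ℕ} (c : Circuit ι g) (x : ι → Bool) (i : ι) :
    c.eval x (Sum.inl i) = x i := by
  cases c <;> rfl

/-- The wires of a circuit, as wires of the circuit with one more gate. -/
def liftWire {ι : Type} {g : ℕ} : ι ⊕ Fin g → ι ⊕ Fin (g + 1) := Sum.map id Fin.castSucc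

lemma Circuit.eval_const_liftWire {ι : Type} {g : ℕ} (c : Circuit ι g) (b : Bool) (x : ι → Bool)
    (w : ι ⊕ Fin g) : (c.const b).eval x (liftWire w) = c.eval x w := by
  cases w with
  | inl i => simp [liftWire, Circuit.eval_inl]
  | inr i => simp [liftWire, Circuit.eval]

lemma Circuit.eval_nand_liftWire {ι : Type} {g : ℕ} (c : Circuit ι g) (u v : ι ⊕ Fin g)
    (x : ι → Bool) (w : ι ⊕ Fin g) : (c.nand u v).eval x (liftWire w) = c.eval x w := by
  cases w with
  | inl i => simp [liftWire, Circuit.eval_inl]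
  | inr i => simp [liftWire, Circuit.eval]

/-- A circuit `d` whose inputs are wires of `c` can be appended to `c`. -/
lemma Circuit.exists_append {ι κ : Type} {g h : ℕ} (c : Circuit ι g) (d : Circuit κ h)
    (σ : κ → ι ⊕ Fin g) :
    ∃ (e : Circuit ι (g + h)) (emb : ι ⊕ Fin g → ι ⊕ Fin (g + h))
      (out : κ ⊕ Fin h → ι ⊕ Fin (g + h)),
      ∀ x, (∀ w, e.eval x (emb w) = c.eval x w) ∧
        ∀ w, e.eval x (out w) = d.eval (fun k => c.eval x (σ k)) w := by
  induction d with
  | nil =>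
    refine ⟨c, id, Sum.elim σ Fin.elim0, fun x => ⟨fun _ => rfl, ?_⟩⟩
    rintro (k | i)
    · rfl
    · exact i.elim0
  | @const h d b ih =>
    obtain ⟨e, emb, out, he⟩ := ih
    refine ⟨e.const b, liftWire ∘ emb, Sum.elim (fun k => liftWire (out (.inl k)))
      (Fin.snoc (α := fun _ => ι ⊕ Fin (g + h + 1)) (fun i => liftWire (out (.inr i)))
        (.inr (Fin.last _))), fun x => ⟨fun w => ?_, ?_⟩⟩
    · exact (e.eval_const_liftWire b x _).trans ((he x).1 w)
    · rintro (k | i)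
      · exact (e.eval_const_liftWire b x _).trans
          (((he x).2 (.inl k)).trans (Circuit.eval_inl _ _ _))
      · refine Fin.lastCases ?_ (fun i => ?_) i
        · simp [Circuit.eval]
        · have := (e.eval_const_liftWire b x _).trans ((he x).2 (.inr i))
          simpa [Circuit.eval] using this
  | @nand h d u v ih =>
    obtain ⟨e, emb, out, he⟩ := ih
    -- The operands of the new gate are wires of `d`; `out` translates them into wires of the
    -- combined circuit.
    refine ⟨e.nand (out u) (out v), liftWire ∘ emb, Sum.elim (fun k => liftWire (out (.inl k)))
      (Fin.snoc (α := fun _ => ι ⊕ Fin (g + h + 1)) (fun i => liftWire (out (.inr i)))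
        (.inr (Fin.last _))), fun x => ⟨fun w => ?_, ?_⟩⟩
    · exact (e.eval_nand_liftWire _ _ x _).trans ((he x).1 w)
    · rintro (k | i)
      · exact (e.eval_nand_liftWire _ _ x _).trans
          (((he x).2 (.inl k)).trans (Circuit.eval_inl _ _ _))
      · refine Fin.lastCases ?_ (fun i => ?_) i
        · simp [Circuit.eval, (he x).2]
        · have := (e.eval_nand_liftWire (out u) (out v) x _).trans ((he x).2 (.inr i))
          simpa [Circuit.eval] using this

/-- `F` is computed by a circuit with at most `s` gates; its outputs are not counted. -/
def GateBound {ι κ : Type} (F : (ι → Bool) → (κ → Bool)) (s : ℕ) : Prop :=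
  ∃ (g : ℕ) (c : Circuit ι g) (out : κ → ι ⊕ Fin g), g ≤ s ∧ ∀ x k, F x k = c.eval x (out k)

lemma HasCircuit.gateBound {ι o : Type} [Fintype o] {f : (ι → Bool) → (o → Bool)} {s : ℕ}
    (h : HasCircuit f s) : GateBound f s := by
  obtain ⟨g, c, out, hs, hf⟩ := h
  exact ⟨g, c, out, by omega, hf⟩

lemma HasCircuit.card_le {ι o : Type} [Fintype o] {f : (ι → Bool) → (o → Bool)} {s : ℕ}
    (h : HasCircuit f s) : Fintype.card o ≤ s := by
  obtain ⟨g, c, out, hs, hf⟩ := h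
  omega

/-- Outputs are charged once, at the end. Up to that point, selecting, permuting and duplicating
wires costs nothing. -/
lemma GateBound.hasCircuit {ι o : Type} [Fintype o] {f : (ι → Bool) → (o → Bool)} {s : ℕ}
    (h : GateBound f s) : HasCircuit f (s + Fintype.card o) := by
  obtain ⟨g, c, out, hs, hf⟩ := h
  exact ⟨g, c, out, by omega, hf⟩

lemma HasCircuit.mono {ι o : Type} [Fintype o] {f : (ι → Bool) → (o → Bool)} {s t : ℕ}
    (h : HasCircuit f s) (hst : s ≤ t) : HasCircuit f t := by
  obtain ⟨g, c, out, hs, hf⟩ := h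
  exact ⟨g, c, out, hs.trans hst, hf⟩

namespace GateBound

variable {ι κ μ : Type}

lemma mono {F : (ι → Bool) → (κ → Bool)} {s t : ℕ} (h : GateBound F s) (hst : s ≤ t) :
    GateBound F t := by
  obtain ⟨g, c, out, hs, hf⟩ := h
  exact ⟨g, c, out, hs.trans hst, hf⟩

lemma congr_fun {F G : (ι → Bool) → (κ → Bool)} {s : ℕ} (h : GateBound F s)
    (hFG : ∀ x k, F x k = G x k) : GateBound G s := by
  obtain rfl : F = G := funext fun x => funext fun k => hFG x k
  exact h

lemma input (r : κ → ι) : GateBound (fun (x : ι → Bool) k => x (r k)) 0 :=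
  ⟨0, .nil, fun k => .inl (r k), le_rfl, fun _ _ => rfl⟩

/-- Two gates suffice for any number of constant outputs: gate 0 is false, gate 1 is true, and each
output points to one of them. -/
lemma const (v : κ → Bool) : GateBound (fun _ : ι → Bool => v) 2 := by
  refine ⟨2, (Circuit.nil.const false).const true,
    fun k => .inr (if v k then (1 : Fin 2) else (0 : Fin 2)), le_rfl, fun x k => ?_⟩
  cases hv : v k
  · simp only [hv, Bool.false_eq_true, if_false]
    exact (Circuit.eval_const_liftWire (Circuit.nil.const false) true x (.inr (0 : Fin 1))).symm
  · simp only [hv, if_true]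
    rfl

lemma reindex {F : (ι → Bool) → (κ → Bool)} {s : ℕ} (h : GateBound F s) (r : μ → κ) :
    GateBound (fun x k => F x (r k)) s := by
  obtain ⟨g, c, out, hs, hf⟩ := h
  exact ⟨g, c, out ∘ r, hs, fun x k => hf x (r k)⟩

lemma comp {F : (ι → Bool) → (κ → Bool)} {G : (κ → Bool) → (μ → Bool)} {s t : ℕ}
    (hG : GateBound G t) (hF : GateBound F s) : GateBound (fun x => G (F x)) (s + t) := by
  obtain ⟨g, c, out, hs, hf⟩ := hF
  obtain ⟨h, d, out', ht, hg⟩ := hG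
  obtain ⟨e, emb, o, he⟩ := c.exists_append d out
  refine ⟨_, e, o ∘ out', Nat.add_le_add hs ht, fun x k => ?_⟩
  refine (hg _ k).trans (Eq.trans ?_ ((he x).2 _).symm)
  congr 1
  exact funext (hf x)

lemma pair {F : (ι → Bool) → (κ → Bool)} {G : (ι → Bool) → (μ → Bool)} {s t : ℕ}
    (hF : GateBound F s) (hG : GateBound G t) :
    GateBound (fun x => Sum.elim (F x) (G x)) (s + t) := by
  obtain ⟨g, c, out, hs, hf⟩ := hF
  obtain ⟨h, d, out', ht, hg⟩ := hG
  -- Attaching `d` to the original inputs rather than to gates of `c` runs both circuits side by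
  -- side.
  obtain ⟨e, emb, o, he⟩ := c.exists_append d Sum.inl
  refine ⟨_, e, Sum.elim (emb ∘ out) (o ∘ out'), Nat.add_le_add hs ht, ?_⟩
  rintro x (k | k)
  · exact (hf x k).trans ((he x).1 _).symm
  · refine (hg x k).trans (Eq.trans ?_ ((he x).2 _).symm)
    congr 1
    exact funext fun i => (c.eval_inl x i).symm

/-- Circuits are added one index at a time. The extra 2 pays for the constant false at indices not
yet treated. -/
lemma family {I : Type} [Fintype I] {F : I → (ι → Bool) → (κ → Bool)} {s : I → ℕ}
    (h : ∀ i, GateBound (F i) (s i)) :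
    GateBound (fun x (q : I × κ) => F q.1 x q.2) (2 + ∑ i, s i) := by
  classical
  have key : ∀ S : Finset I, GateBound (fun x (q : I × κ) => if q.1 ∈ S then F q.1 x q.2 else false)
      (2 + ∑ i ∈ S, s i) := by
    intro S
    induction S using Finset.induction_on with
    | empty => simpa using const (ι := ι) (fun _ : I × κ => false)
    | insert a S ha ih =>
      rw [Finset.sum_insert ha]
      have := (ih.pair (h a)).reindex
        (fun q : I × κ => if q.1 = a then Sum.inr q.2 else Sum.inl q)
      refine (this.mono (by omega)).congr_fun ?_
      rintro x ⟨i, k⟩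
      by_cases hi : i = a
      · subst hi; simp
      · simp [hi]
  simpa using key Finset.univ

end GateBound

/-! ### Probability -/

section Prob

variable {Ω α β : Type} [Fintype Ω]

lemma prob_nonneg (E : Ω → Prop) : 0 ≤ prob E := by
  unfold prob; positivity

lemma prob_mono {E F : Ω → Prop} (h : ∀ ω, E ω → F ω) : prob E ≤ prob F := by
  classical
  unfold prob
  gcongr with ω
  exact h ω

lemma prob_or_le (E F : Ω → Prop) : prob (fun ω => E ω ∨ F ω) ≤ prob E + prob F := by
  classical
  unfold prob
  rw [← add_div]
  gcongr
  norm_cast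
  convert Finset.card_union_le (Finset.univ.filter E) (Finset.univ.filter F) using 2
  ext; simp

lemma prob_exists_le (s : Finset α) (E : α → Ω → Prop) :
    prob (fun ω => ∃ a ∈ s, E a ω) ≤ ∑ a ∈ s, prob (E a) := by
  classical
  induction s using Finset.induction_on with
  | empty => simp [prob]
  | insert a s ha ih =>
    rw [Finset.sum_insert ha]
    refine le_trans (prob_mono ?_) ((prob_or_le (E a) _).trans (add_le_add le_rfl ih))
    simp

lemma prob_equiv [Fintype α] (e : Ω ≃ α) (E : α → Prop) : prob (fun ω => E (e ω)) = prob E := by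
  classical
  unfold prob
  rw [Fintype.card_congr e]
  congr 2
  refine Finset.card_bij (fun ω _ => e ω) (by simp) (by simp) fun a ha => ?_
  exact ⟨e.symm a, by simpa using ha, by simp⟩

/-- The probability of `E` is the average of its slices over `b`. This is how coins irrelevant to a
security assumption are frozen. -/
lemma prob_prod_le [Fintype α] [Fintype β] [Nonempty β] {E : α × β → Prop} {t : ℝ}
    (h : ∀ b, prob (fun a => E (a, b)) ≤ t) : prob E ≤ t := by
  classical
  have hβ : (0 : ℝ) < Fintype.card β := by exact_mod_cast Fintype.card_pos
  have hsum : prob E = (∑ b, prob fun a => E (a, b)) / Fintype.card β := by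
    unfold prob
    rw [← Finset.sum_div, Fintype.card_prod, Nat.cast_mul, div_div]
    congr 1
    norm_cast
    rw [← Finset.card_sigma]
    refine Finset.card_bij (fun q _ => ⟨q.2, q.1⟩) (by simp) ?_ ?_
    · rintro ⟨a, b⟩ _ ⟨a', b'⟩ _ h
      simp only [Sigma.mk.injEq, heq_eq_eq] at h
      simp [h.1, h.2]
    · rintro ⟨b, a⟩ hab
      exact ⟨(a, b), by simpa using hab, rfl⟩
  rw [hsum, div_le_iff₀ hβ]
  calc ∑ b, prob (fun a => E (a, b)) ≤ ∑ _b : β, t := Finset.sum_le_sum fun b _ => h b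
    _ = t * Fintype.card β := by simp [mul_comm]

end Prob

/-! ### Closure of negligible functions under finite sums -/

lemma Negligible.add {μ ν : ℕ → ℝ} (hμ : Negligible μ) (hν : Negligible ν) :
    Negligible fun κ => μ κ + ν κ :=
  Asymptotics.SuperpolynomialDecay.add hμ hν

lemma Negligible.sum {I : Type} (s : Finset I) {μ : I → ℕ → ℝ} (h : ∀ i ∈ s, Negligible (μ i)) :
    Negligible fun κ => ∑ i ∈ s, μ i κ := by
  classical
  induction s using Finset.induction_on with
  | empty =>
    simp only [Finset.sum_empty]
    exact Asymptotics.superpolynomialDecay_zero Filter.atTop fun κ : ℕ => (κ : ℝ)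
  | insert a s ha ih =>
    simp only [Finset.sum_insert ha]
    exact (h a (by simp)).add (ih fun i hi => h i (by simp [hi]))

/-! ### Medians of timestamps -/

/-- Honest members form a majority, so the median of `R` is at most the largest honest `R p`. If the
median of `S` were no larger than that, only corrupted members could have `S q` at or below it, and
they are fewer than half. -/
lemma medianStamp_lt_medianStamp {n : ℕ} {C : Finset (Fin n)} (hC : 2 * C.card < n)
    {R S : Fin n → ℕ} (h : ∀ p ∉ C, ∀ q ∉ C, R p < S q) : medianStamp R < medianStamp S := by
  classical
  have hcompl : n < 2 * Cᶜ.card := by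
    have := C.card_add_card_compl
    rw [Fintype.card_fin] at this
    omega
  have hne : Cᶜ.Nonempty := by
    rw [← Finset.card_pos]; omega
  obtain ⟨p, hp, hmax⟩ := Finset.exists_max_image Cᶜ R hne
  have hR : medianStamp R ≤ R p := by
    refine Nat.sInf_le (hcompl.trans_le ?_)
    gcongr
    intro q hq
    simpa using hmax q hq
  -- The infimum is attained because the set is nonempty: it contains the largest timestamp.
  have hS : n < 2 * (Finset.univ.filter fun q => S q ≤ medianStamp S).card := by
    refine Nat.sInf_mem (s := {v | n < 2 * (Finset.univ.filter fun q => S q ≤ v).card})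
      ⟨Finset.univ.sup S, ?_⟩
    have : (Finset.univ.filter fun q => S q ≤ Finset.univ.sup S) = Finset.univ :=
      Finset.filter_true_of_mem fun q _ => Finset.le_sup (Finset.mem_univ q)
    simp only [Set.mem_ofPred_eq, this, Finset.card_univ, Fintype.card_fin]
    omega
  by_contra! hle
  have : (Finset.univ.filter fun q => S q ≤ medianStamp S) ⊆ C := by
    intro q hq
    by_contra hqC
    have h1 := h p (by simpa using hp) q hqC
    simp only [Finset.mem_filter, Finset.mem_univ, true_and] at hq
    omega
  have := Finset.card_le_card this
  omega

/-! ### Serialization -/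

namespace Primitives

variable {n : ℕ} (P : Primitives n)

/-- The length of the serialization of `m` entries. -/
def encodeLen (m κ : ℕ) : ℕ :=
  m * (m + (P.sym.ctLen κ + (P.thr.ctLen κ + P.auxLen κ)))

/-- The position in a list of entries of a bit of its serialization. -/
def encodeEquiv (m κ : ℕ) : Fin (P.encodeLen m κ) ≃ Fin m × P.EntryWire m κ :=
  finProdFinEquiv.symm.trans (Equiv.prodCongr (Equiv.refl _) (P.entryEquiv m κ))

lemma encode_eq {m κ : ℕ} (L : Fin m → P.EntryWire m κ → Bool) :
    P.encode L = List.ofFn fun t =>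
      L (P.encodeEquiv m κ t).1 (P.encodeEquiv m κ t).2 := rfl

lemma encode_injective {m κ : ℕ} :
    Function.Injective (P.encode : (Fin m → P.EntryWire m κ → Bool) → List Bool) := by
  intro L L' h
  rw [encode_eq, encode_eq] at h
  have h := List.ofFn_injective h
  ext a b
  simpa using congrFun h ((P.encodeEquiv m κ).symm (a, b))

/-- The one-hot receipt number identifies the submission even when two encrypted transactions
coincide. -/
lemma entry_fst_injective {m κ : ℕ} {k l : Fin m} {tx tx' : P.TxWire κ → Bool}
    (h : P.entry k tx = P.entry l tx') : k = l := by
  have := congrFun h (.inl k)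
  simpa [entry] using this

end Primitives

namespace Adversary

variable {n : ℕ} {P : Primitives n} {W : Workload P} (A : Adversary W) (C : Finset (Fin n))

/-! ### The run of the protocol as a function of the hash key -/

/-- All coins of a run but those for the hash key. -/
abbrev OtherCoins (κ : ℕ) : Type :=
  Bits (P.thr.dkgCoinLen κ) × (Fin (W.m κ) → Bits (P.thr.keyLen κ)) ×
    (Fin (W.m κ) → Bits (P.sym.coinLen κ)) × (Fin (W.m κ) → Bits (P.thr.encCoinLen κ)) ×
    Bits (A.coinLen κ)

variable {κ : ℕ} (r : A.OtherCoins κ) (hk : Bits (P.hash.keyLen κ))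

/-- A collision finder receives the hash key but not the coins that generated it, so the key becomes
an explicit argument. The all-false string is a placeholder for those coins: the remaining parts of
the view do not depend on them. -/
def viewOf : W.ViewWire A.coinLen κ → Bool :=
  Sum.elim hk fun w => A.view C κ (fun _ => false, r) (.inr w)

def ctKeyOf (q : Fin (W.m κ) × Fin (P.thr.ctLen κ)) : Bool :=
  if q.1 ∈ W.honest κ then A.userTx κ (fun _ => false, r) q.1 (.inr (.inl q.2))
  else A.submit κ (A.viewOf C r hk) (q.1, .inr (.inl q.2))

def shareOf (p : Fin n) (k : Fin (W.m κ)) : Bits (P.thr.shareLen κ) :=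
  P.thr.shareDec κ p (A.secretKey κ (fun _ => false, r) p) fun b => A.ctKeyOf C r hk (k, b)

def lateViewOf : W.LateViewWire A.coinLen κ → Bool :=
  Sum.elim (A.viewOf C r hk) fun q =>
    if q.1 ∈ C then false else A.shareOf C r hk q.1 q.2.1 q.2.2

lemma view_eq (h : Bits (P.hash.coinLen κ)) :
    A.view C κ (h, r) = A.viewOf C r (P.hash.gen κ h) := by
  funext w
  rcases w with w | w | w | w | w <;> rfl

lemma ctKey_eq (h : Bits (P.hash.coinLen κ)) (k : Fin (W.m κ)) :
    A.ctKey C κ (h, r) k = fun b => A.ctKeyOf C r (P.hash.gen κ h) (k, b) := by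
  funext b
  unfold ctKey txEnc ctKeyOf
  rw [view_eq]
  split_ifs <;> rfl

lemma lateView_eq (h : Bits (P.hash.coinLen κ)) :
    A.lateView C κ (h, r) = A.lateViewOf C r (P.hash.gen κ h) := by
  unfold lateView lateViewOf
  rw [view_eq]
  simp only [ctKey_eq]
  rfl

lemma gateBound_viewOf : GateBound (A.viewOf C r) 2 := by
  have := (GateBound.input (κ := Fin (P.hash.keyLen κ)) id).pair
    (GateBound.const fun w => A.view C κ (fun _ => false, r) (.inr w))
  exact this.mono (by omega)

lemma gateBound_ctKeyOf {s : ℕ} (hs : GateBound (A.submit κ) s) :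
    GateBound (A.ctKeyOf C r) (s + 4) := by
  have := ((GateBound.const fun q : Fin (W.m κ) × Fin (P.thr.ctLen κ) =>
    A.userTx κ (fun _ => false, r) q.1 (.inr (.inl q.2))).pair
      (hs.comp (A.gateBound_viewOf C r))).reindex
    (fun q : Fin (W.m κ) × Fin (P.thr.ctLen κ) =>
      if q.1 ∈ W.honest κ then Sum.inl q else Sum.inr (q.1, .inr (.inl q.2)))
  refine (this.mono (by omega)).congr_fun fun x q => ?_
  unfold ctKeyOf
  split_ifs <;> rfl

/-- Each share pays for the constant secret key (2), its ciphertext (`s + 4`) and the decryption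
circuit (`t p`). The leading 6 is 2 for the early view, 2 for `GateBound.family` and 2 for the
blanks of corrupted members. -/
lemma gateBound_lateViewOf {s : ℕ} (hs : GateBound (A.submit κ) s) {t : Fin n → ℕ}
    (ht : ∀ p, GateBound
      (fun (x : Fin (P.thr.skLen κ) ⊕ Fin (P.thr.ctLen κ) → Bool) =>
        P.thr.shareDec κ p (fun b => x (.inl b)) (fun b => x (.inr b))) (t p)) :
    GateBound (A.lateViewOf C r) (6 + W.m κ * ∑ p, (s + 6 + t p)) := by
  have hshare : ∀ q : Fin n × Fin (W.m κ),
      GateBound (fun hk => A.shareOf C r hk q.1 q.2) (s + 6 + t q.1) := fun q =>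
    ((ht q.1).comp ((GateBound.const (A.secretKey κ (fun _ => false, r) q.1)).pair
      ((A.gateBound_ctKeyOf C r hs).reindex fun b => (q.2, b)))).mono (by omega)
  have := (A.gateBound_viewOf C r).pair
    (((GateBound.family hshare).pair (GateBound.const fun _ : Unit => false)).reindex
      fun q : Fin n × Fin (W.m κ) × Fin (P.thr.shareLen κ) =>
        if q.1 ∈ C then Sum.inr () else Sum.inl ((q.1, q.2.1), q.2.2))
  refine (this.mono ?_).congr_fun ?_
  · rw [Fintype.sum_prod_type, Finset.mul_sum]
    simp only [Finset.sum_const, Finset.card_univ, Fintype.card_fin, smul_eq_mul]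
    omega
  · rintro x (w | q)
    · rfl
    · simp only [lateViewOf, Sum.elim_inr]
      split_ifs <;> rfl

/-! ### The collision finders -/

/-- The list shown to member `p` and the list that opens the commitment, both serialized. -/
def ordersOf (p : Fin n) :
    Fin (P.encodeLen (W.m κ) κ) ⊕ Fin (P.encodeLen (W.m κ) κ) → Bool :=
  Sum.elim (fun t => A.proposal κ (A.viewOf C r hk) (p, P.encodeEquiv _ κ t))
    (fun t => A.opening κ (A.lateViewOf C r hk) (P.encodeEquiv _ κ t))

lemma polySize_ordersOf (heff : P.thr.IsEfficient) (r : ∀ κ, A.OtherCoins κ) (p : Fin n) :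
    PolySize fun κ (x : Fin (P.hash.keyLen κ) ⊕ Fin 0 → Bool) =>
      A.ordersOf C (r κ) (fun b => x (.inl b)) p := by
  obtain ⟨S, hS⟩ := A.submit_poly
  obtain ⟨Q, hQ⟩ := A.proposal_poly
  obtain ⟨O, hO⟩ := A.opening_poly
  choose T hT using heff.shareDec
  -- The summands pay for the early view, the proposal, the late view and the opening. The final `2
  -- * O` pays for the output bits of the two serializations.
  refine ⟨2 + Q + (6 + O * ∑ q, (S + 6 + T q) + O) + 2 * O, fun κ => ?_⟩
  -- The adversary's opening has exactly the bits of one serialized list, and circuit size counts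
  -- outputs. Its size therefore bounds the length of the list and, with it, the number of
  -- submissions.
  have hlen : P.encodeLen (W.m κ) κ ≤ O.eval κ := by
    have := (hO κ).card_le
    rwa [← Fintype.card_congr (P.encodeEquiv _ κ), Fintype.card_fin] at this
  have hm : W.m κ ≤ O.eval κ := by
    refine le_trans ?_ hlen
    unfold Primitives.encodeLen
    rcases Nat.eq_zero_or_pos (W.m κ) with h | h
    · omega
    · exact Nat.le_mul_of_pos_right _ (by omega)
  have hlate := A.gateBound_lateViewOf C (r κ) (hS κ).gateBound fun q => (hT q κ).gateBound
  have := (((((hQ κ).gateBound.comp (A.gateBound_viewOf C (r κ))).reindex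
      fun t => (p, P.encodeEquiv _ κ t)).pair
    (((hO κ).gateBound.comp hlate).reindex (P.encodeEquiv _ κ))).comp
      (GateBound.input (ι := Fin (P.hash.keyLen κ) ⊕ Fin 0) Sum.inl)).hasCircuit
  refine HasCircuit.mono this ?_
  simp only [Fintype.card_sum, Fintype.card_fin, Polynomial.eval_add, Polynomial.eval_mul,
    Polynomial.eval_finsetSum, Polynomial.eval_ofNat]
  have := Nat.mul_le_mul_right (∑ q, (S.eval κ + 6 + (T q).eval κ)) hm
  omega

/-- The collision finder that runs the protocol with fixed coins and outputs the list shown to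
member `p` and the list that opens the commitment. -/
def collisionFinder (heff : P.thr.IsEfficient) (r : ∀ κ, A.OtherCoins κ) (p : Fin n) :
    CollisionFinder P.hash where
  coinLen _ := 0
  len₁ κ := P.encodeLen (W.m κ) κ
  len₂ κ := P.encodeLen (W.m κ) κ
  run κ x := A.ordersOf C (r κ) (fun b => x (.inl b)) p
  polySize := A.polySize_ordersOf C heff r p

/-- The list shown to member `p` and the final order are different openings of the commitment. -/
def Equivocates (κ : ℕ) (p : Fin n) (ω : A.Coins κ) : Prop :=
  A.Opens C κ ω (fun a b => A.proposal κ (A.view C κ ω) (p, a, b)) ∧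
    A.Opens C κ ω (A.finalOrder C κ ω) ∧
    (fun a b => A.proposal κ (A.view C κ ω) (p, a, b)) ≠ A.finalOrder C κ ω

lemma collisionFinder_succeeds (heff : P.thr.IsEfficient) (r : ∀ κ, A.OtherCoins κ) (p : Fin n)
    (κ : ℕ) (h : Bits (P.hash.coinLen κ)) (z : Bits 0) (hE : A.Equivocates C κ p (h, r κ)) :
    (A.collisionFinder C heff r p).Succeeds κ (h, z) := by
  obtain ⟨h1, h2, hne⟩ := hE
  have e1 : P.encode (fun a b => A.proposal κ (A.view C κ (h, r κ)) (p, a, b)) =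
      List.ofFn fun t => A.ordersOf C (r κ) (P.hash.gen κ h) p (.inl t) := by
    rw [P.encode_eq, view_eq]; rfl
  have e2 : P.encode (A.finalOrder C κ (h, r κ)) =
      List.ofFn fun t => A.ordersOf C (r κ) (P.hash.gen κ h) p (.inr t) := by
    rw [P.encode_eq]; unfold finalOrder; rw [lateView_eq]; rfl
  have hne' := fun he => hne (P.encode_injective he)
  have heq := h1.trans h2.symm
  rw [e1, e2] at hne' heq
  exact ⟨hne', heq⟩

/-- For each security parameter, the coins other than those of the hash key are fixed at values
maximizing the conditional probability of equivocation. Non-uniform circuits may carry them as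
advice, and the average over these coins is at most the maximum. -/
lemma exists_negligible_equivocates (hhash : P.hash.CollisionResistant)
    (heff : P.thr.IsEfficient) (p : Fin n) :
    ∃ ε : ℕ → ℝ, Negligible ε ∧ ∀ κ, prob (A.Equivocates C κ p) ≤ ε κ := by
  have hmax : ∀ κ, ∃ r : A.OtherCoins κ, ∀ r' : A.OtherCoins κ,
      prob (fun h => A.Equivocates C κ p (h, r')) ≤ prob (fun h => A.Equivocates C κ p (h, r)) :=
    fun κ => Finite.exists_max _
  choose r hr using hmax
  refine ⟨_, hhash (A.collisionFinder C heff r p), fun κ => prob_prod_le fun r' => ?_⟩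
  refine (hr κ r').trans ?_
  -- The finder is deterministic; its coin space `Bits 0` has a single point.
  rw [← prob_equiv (Equiv.prodUnique (Bits (P.hash.coinLen κ)) (Bits 0))]
  exact prob_mono fun ω hω => A.collisionFinder_succeeds C heff r p κ ω.1 ω.2 hω

/-! ### Decryption of honest transactions -/

/-- Splits off the coins for key generation and for the encryption of the key of submission `i`. -/
def coinsEquiv (κ : ℕ) (i : Fin (W.m κ)) :
    A.Coins κ ≃ (Bits (P.thr.dkgCoinLen κ) × Bits (P.thr.encCoinLen κ)) ×
      (Bits (P.hash.coinLen κ) × (Fin (W.m κ) → Bits (P.thr.keyLen κ)) ×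
        (Fin (W.m κ) → Bits (P.sym.coinLen κ)) ×
        ({j // j ≠ i} → Bits (P.thr.encCoinLen κ)) × Bits (A.coinLen κ)) where
  toFun ω := ((ω.2.1, ω.2.2.2.2.1 i), ω.1, ω.2.2.1, ω.2.2.2.1, fun j => ω.2.2.2.2.1 j,
    ω.2.2.2.2.2)
  invFun q := (q.2.1, q.1.1, q.2.2.1, q.2.2.2.1,
    (Equiv.funSplitAt i _).symm (q.1.2, q.2.2.2.2.1), q.2.2.2.2.2)
  left_inv ω := by
    have : (Equiv.funSplitAt i _).symm (ω.2.2.2.2.1 i, fun j => ω.2.2.2.2.1 j) = ω.2.2.2.2.1 :=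
      (Equiv.funSplitAt i _).symm_apply_apply _
    simp only [this]
  right_inv q := by
    have := (Equiv.funSplitAt i _).apply_symm_apply (q.1.2, q.2.2.2.2.1)
    simp only [Equiv.funSplitAt_apply, Prod.mk.injEq] at this
    simp only [this.1, this.2]

/-- Once all other coins are frozen, the coins for key generation and for encrypting the key of `i`
are still uniform, and the symmetric key is a fixed string. This is the experiment of
`ThresholdScheme.Correct`. -/
lemma prob_plaintext_ne_le {ε : ℕ → ℝ}
    (hε : ∀ (κ : ℕ) (key : Bits (P.thr.keyLen κ)),
      prob (fun ω : Bits (P.thr.dkgCoinLen κ) × Bits (P.thr.encCoinLen κ) =>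
        let keys := P.thr.dkg κ ω.1
        let ct := P.thr.enc κ keys.1 key ω.2
        ∃ shares : Fin n → Bits (P.thr.shareLen κ),
          (∀ p, p ∉ C → shares p = P.thr.shareDec κ p (keys.2 p) ct) ∧
          P.thr.combine κ keys.1 ct shares ≠ key) ≤ ε κ)
    (κ : ℕ) {i : Fin (W.m κ)} (hi : i ∈ W.honest κ) :
    prob (fun ω : A.Coins κ => A.plaintext C κ ω i ≠ W.payload κ i) ≤ ε κ := by
  rw [← prob_equiv (A.coinsEquiv κ i).symm]
  refine prob_prod_le fun b => le_trans (prob_mono fun a ha => ?_) (hε κ (b.2.1 i))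
  set ω := (A.coinsEquiv κ i).symm (a, b) with hω
  have hcoin : ω.2.2.2.2.1 i = a.2 := by
    have := congrArg (fun q => q.1.2) ((A.coinsEquiv κ i).apply_symm_apply (a, b))
    exact this
  have hct : A.ctKey C κ ω i = P.thr.enc κ (P.thr.dkg κ a.1).1 (b.2.1 i) a.2 := by
    funext t
    simp only [ctKey, txEnc, if_pos hi, userTx, Workload.userTx, Sum.elim_inr, Sum.elim_inl, hcoin]
    rfl
  have hsym : A.ctSym C κ ω i = P.sym.enc κ (b.2.1 i) (W.payload κ i) (ω.2.2.2.1 i) := by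
    funext t
    simp only [ctSym, txEnc, if_pos hi, userTx, Workload.userTx, Sum.elim_inl]
    rfl
  -- The shares of the run serve as witness. Corrupted shares may depend on every coin, since the
  -- error event quantifies over shares after the coins are drawn.
  refine ⟨A.memberShare C κ ω i, fun p hp => ?_, fun hkey => ha ?_⟩
  · rw [memberShare, if_neg hp, hct]
    rfl
  · have hkey' : P.thr.combine κ (A.publicKey κ ω) (A.ctKey C κ ω i) (A.memberShare C κ ω i) =
        b.2.1 i := by
      rw [hct]; exact hkey
    rw [plaintext, hkey', hsym, P.sym.dec_enc]

/-! ### Order of execution -/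

lemma exists_approves_of_committed {ω : A.Coins κ} (hC : 2 * C.card < n)
    (h : A.Committed C κ ω) : ∃ p ∉ C, A.Approves C κ ω p := by
  classical
  by_contra! hno
  have hle : (Finset.univ.filter fun p => A.Approves C κ ω p).card ≤ C.card := by
    refine Finset.card_le_card fun p hp => ?_
    by_contra hpC
    exact hno p hpC (by simpa using hp)
  have h' : n < 2 * (Finset.univ.filter fun p => A.Approves C κ ω p).card := by
    unfold Committed at h
    convert h
  omega

/-- The skew bound compares different members on different submissions, so it controls `stamp p i -
stamp q j` directly. -/
lemma recorded_lt_recorded {α : ℝ} (hC : 2 * C.card < n) (hskew : W.BoundedSkew C α)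
    (ω : A.Coins κ) {i j : Fin (W.m κ)} (hij : W.arrival κ i < W.arrival κ j - α) :
    A.recorded C κ ω i < A.recorded C κ ω j := by
  refine medianStamp_lt_medianStamp hC fun p hp q hq => ?_
  rw [memberStamp, memberStamp, if_neg hp, if_neg hq]
  have := hskew κ p hp q hq i j
  exact_mod_cast (by linarith : (W.stamp κ p i : ℝ) < W.stamp κ q j)

/-- In a sorted list `i` occupies slot `τ.symm i`, ahead of every slot holding `j`. If that slot
counted as executing `i`, the position of `i` would be smaller than that of `j`. -/
lemma plaintext_ne_of_position_lt {ω : A.Coins κ}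
    (hsorted : A.IsArrivalOrder C κ ω (A.finalOrder C κ ω)) {i j : Fin (W.m κ)}
    (hij : A.recorded C κ ω i < A.recorded C κ ω j)
    (hpos : A.position C κ ω j < A.position C κ ω i) :
    i ∈ W.honest κ ∧ A.plaintext C κ ω i ≠ W.payload κ i := by
  obtain ⟨τ, hmono, hτ⟩ := hsorted
  obtain ⟨a, ha⟩ := iInf_lt_iff.1 hpos
  obtain ⟨hex, ha⟩ := iInf_lt_iff.1 ha
  have haj : τ a = j := P.entry_fst_injective ((hτ a).symm.trans hex.2.1)
  by_contra! hi
  -- Acceptance concerns the whole batch, so it carries over from the execution of `j`.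
  have hexi : A.Executes C κ ω (τ.symm i) i := ⟨hex.1, by rw [hτ, τ.apply_symm_apply], hi⟩
  -- Strict inequality of the recorded times excludes ties, whose order is arbitrary.
  have hlt : τ.symm i < a := by
    by_contra! hle
    have := hmono hle
    simp only [haj, τ.apply_symm_apply] at this
    omega
  have hle : A.position C κ ω i ≤ ((τ.symm i : ℕ) : ℕ∞) := 
    iInf₂_le (f := fun (a : Fin (W.m κ)) (_ : A.Executes C κ ω a i) => ((a : ℕ) : ℕ∞)) _ hexi
  have : (a : ℕ) < (τ.symm i : ℕ) := by exact_mod_cast ha.trans_le hle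
  exact absurd hlt (not_lt.2 (Fin.le_def.2 this.le))

lemma misordering_cases {α : ℝ} (hC : 2 * C.card < n) (hskew : W.BoundedSkew C α)
    {ω : A.Coins κ} {i j : Fin (W.m κ)} (hij : W.arrival κ i < W.arrival κ j - α)
    (hpos : A.position C κ ω j < A.position C κ ω i) :
    (i ∈ W.honest κ ∧ A.plaintext C κ ω i ≠ W.payload κ i) ∨
      ∃ p ∈ Finset.univ, A.Equivocates C κ p ω := by
  -- A position below another one is finite, so some slot executes `j` and the batch was accepted.
  obtain ⟨a, ha⟩ := iInf_lt_iff.1 hpos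
  obtain ⟨hex, -⟩ := iInf_lt_iff.1 ha
  obtain ⟨⟨hcom, hopen⟩, -⟩ := hex
  obtain ⟨p, hp, happ⟩ := A.exists_approves_of_committed C hC hcom
  obtain ⟨hpC, -⟩ | ⟨-, hpopen, hsorted⟩ := happ
  · exact absurd hpC hp
  by_cases heq : (fun a b => A.proposal κ (A.view C κ ω) (p, a, b)) = A.finalOrder C κ ω
  · rw [heq] at hsorted
    exact .inl (A.plaintext_ne_of_position_lt C hsorted
      (A.recorded_lt_recorded C hC hskew ω hij) hpos)
  · exact .inr ⟨p, Finset.mem_univ p, hpopen, hopen, heq⟩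

end Adversary

end FairOrdering

theorem theorem3 {n : ℕ} (f : ℕ) (hf : 2 * f < n) (C : Finset (Fin n)) (hC : C.card ≤ f)
    (P : Primitives n) (hhash : P.hash.CollisionResistant)
    (heff : P.thr.IsEfficient) (hcorrect : P.thr.Correct f)
    (α : ℝ) (W : Workload P) (hskew : W.BoundedSkew C α) (A : Adversary W) :
    ∃ β : ℕ → ℝ, Negligible β ∧
      ∀ κ, IsFair (W.arrival κ) (fun ω : A.Coins κ => A.position C κ ω) α (β κ) := by
  have hC2 : 2 * C.card < n := by omega
  obtain ⟨ε, hε, hdec⟩ := hcorrect C hC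
  choose η hη hcoll using A.exists_negligible_equivocates C hhash heff
  -- One decryption error and `n` possible equivocations: the bound depends on neither `i` nor `j`.
  have hβ := hε.add (Negligible.sum Finset.univ fun p _ => hη p)
  refine ⟨_, hβ, fun κ i j hij => ?_⟩
  have hsum : prob (fun ω : A.Coins κ => ∃ p ∈ Finset.univ, A.Equivocates C κ p ω) ≤
      ∑ p, η p κ :=
    (prob_exists_le _ _).trans (Finset.sum_le_sum fun p _ => hcoll p κ)
  refine (prob_mono fun ω hω => A.misordering_cases C hC2 hskew hij hω).trans
    ((prob_or_le _ _).trans (add_le_add ?_ hsum))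
  by_cases hi : i ∈ W.honest κ
  · simpa [hi] using A.prob_plaintext_ne_le C hdec κ hi
  · have h0 : prob (fun ω : A.Coins κ =>
        i ∈ W.honest κ ∧ A.plaintext C κ ω i ≠ W.payload κ i) = 0 := by
      simp [prob, hi]
    rw [h0]
    -- A malicious `i` has no decryption condition to violate. Only `0 ≤ ε κ` is needed, and it
    -- follows from the correctness bound at an arbitrary key.
    exact (prob_nonneg _).trans (hdec κ fun _ => false)
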